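/- Let $M$ be a smooth manifold (without boundary), let $\iota : Z \hookrightarrow M$ be a smoothly embedded hypersurface that is closed as a subset of $M$ (we identify $Z$ with its image), and let $\pi : Z \to N$ be a smooth fibration, i.e. a smooth locally trivial fibre bundle over a smooth manifold $N$, with typical fibre a smooth manifold $F$; the triple $(M,Z,\pi)$ is called an edge structure. An edge vector field is a smooth vector field on $M$ which at every point of $Z$ is tangent to the fibre of $\pi$ through that point. The edge tangent bundle ${}^eTM \to M$ is the smooth vector bundle whose smooth sections are the edge vector fields (given by the Serre--Swan theorem: its fibre at $p$ is $\Gamma/\mathfrak m_p\Gamma$, where $\Gamma$ is the $C^\infty(M)$-module of edge vector fields and $\mathfrak m_p\subset C^\infty(M)$ is the ideal of functions vanishing at $p$). The associated graph $G_{M,Z}$ has as nodes the connected components of $M\setminus Z$ and as edges the connected components of $Z$; a node $M_\alpha$ is an end of an edge $Z_\gamma$ if and only if $\overline{M_\alpha}\cap Z_\gamma\neq\emptyset$, and an edge with only one end node is a loop. The graph is two-colorable if its nodes can be coloured with two colours $+,-$ so that every edge has exactly two distinct end nodes, and these are coloured differently (in particular, there are no loops). Proposition. Assume that $\dim M-\dim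 F=2k+1$ is odd. If ${}^eTM$ is isomorphic to $TM$ as a smooth vector bundle over $M$, then the graph $G_{M,Z}$ is two-colorable. -/

import Mathlib

open scoped Manifold ContDiff

noncomputable section

namespace EdgeGeometry

/-! ### Edge structures -/

section Structures

variable (d q r : ℕ)
  {M : Type*} [TopologicalSpace M] [ChartedSpace (EuclideanSpace ℝ (Fin (d + 1))) M]
  {Z : Type*} [TopologicalSpace Z] [ChartedSpace (EuclideanSpace ℝ (Fin d)) Z]
  {N : Type*} [TopologicalSpace N] [ChartedSpace (EuclideanSpace ℝ (Fin q)) N]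
  (F : Type*) [TopologicalSpace F] [ChartedSpace (EuclideanSpace ℝ (Fin r)) F]

/-- `π : Z → N` is a smooth fibration (a smooth locally trivial fibre bundle) with typical
fibre `F`: every point of `N` has an open neighbourhood `U` with a diffeomorphism
`π⁻¹(U) ≅ U × F` over `U`. -/
def IsSmoothFibration (π : Z → N) : Prop :=
  ∀ b : N, ∃ e : Bundle.Trivialization F π, b ∈ e.baseSet ∧
    ContMDiffOn (𝓡 d) ((𝓡 q).prod (𝓡 r)) ∞ e e.source ∧
    ContMDiffOn ((𝓡 q).prod (𝓡 r)) (𝓡 d) ∞ e.toOpenPartialHomeomorph.symm e.target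

/-- An edge structure on the `(d+1)`-dimensional manifold `M`: an embedded hypersurface
`ι : Z → M`, closed as a subset of `M`, with a smooth fibration `π : Z → N` of typical
fibre `F`. -/
structure IsEdgeStructure (ι : Z → M) (π : Z → N) : Prop where
  isSmoothEmbedding : Manifold.IsSmoothEmbedding (𝓡 d) (𝓡 (d + 1)) ∞ ι
  isClosed_range : IsClosed (Set.range ι)
  isSmoothFibration : IsSmoothFibration d q r F π

end Structures

/-! ### The edge tangent bundle -/

section Bundle

variable (d q : ℕ)
  {M : Type*} [TopologicalSpace M] [ChartedSpace (EuclideanSpace ℝ (Fin (d + 1))) M]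
  [IsManifold (𝓡 (d + 1)) ∞ M]
  {Z : Type*} [TopologicalSpace Z] [ChartedSpace (EuclideanSpace ℝ (Fin d)) Z]
  {N : Type*} [TopologicalSpace N] [ChartedSpace (EuclideanSpace ℝ (Fin q)) N]

variable (M) in
/-- The smooth vector fields on `M`. -/
abbrev VectorFields : Type _ :=
  ContMDiffSection (𝓡 (d + 1)) (EuclideanSpace ℝ (Fin (d + 1))) ∞
    (TangentSpace (𝓡 (d + 1)) : M → Type)

/-- The tangent space at `ι z`, as a subspace of `T_{ι z} M`, of the fibre of `π` through `z`. -/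
def fibreTangent (ι : Z → M) (π : Z → N) (z : Z) :
    Submodule ℝ (TangentSpace (𝓡 (d + 1)) (ι z)) :=
  Submodule.map (mfderiv (𝓡 d) (𝓡 (d + 1)) ι z).toLinearMap
    (LinearMap.ker (mfderiv (𝓡 d) (𝓡 q) π z).toLinearMap)

/-- The edge vector fields: the smooth vector fields on `M` which along the hypersurface are
tangent to the fibres of `π` (and hence to the hypersurface). -/
def edgeVectorFields (ι : Z → M) (π : Z → N) : Submodule ℝ (VectorFields d M) where
  carrier := {X | ∀ z : Z, X (ι z) ∈ fibreTangent d q ι π z}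
  add_mem' hX hY z := (fibreTangent d q ι π z).add_mem (hX z) (hY z)
  zero_mem' z := (fibreTangent d q ι π z).zero_mem
  smul_mem' c _ hX z := (fibreTangent d q ι π z).smul_mem c (hX z)

/-- The subspace `𝔪_p · Γ` of the space `Γ` of edge vector fields, where `𝔪_p` is the ideal of
the smooth functions on `M` that vanish at `p`: the finite sums of products `f X` with `f` in
`𝔪_p` and `X` an edge vector field. -/
def vanishingSubmodule (ι : Z → M) (π : Z → N) (p : M) :
    Submodule ℝ (edgeVectorFields d q ι π) :=
  Submodule.span ℝ {W | ∃ (f : M → ℝ) (X : edgeVectorFields d q ι π),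
    ContMDiff (𝓡 (d + 1)) 𝓘(ℝ, ℝ) ∞ f ∧ f p = 0 ∧ ∀ x : M, W.1 x = f x • X.1 x}

/-- The fibre at `p` of the edge tangent bundle: the fibre `Γ / 𝔪_p Γ` at `p` of the vector
bundle which the Serre-Swan theorem attaches to the `C^∞(M)`-module `Γ` of edge vector fields. -/
abbrev EdgeTangentSpace (ι : Z → M) (π : Z → N) (p : M) : Type _ :=
  edgeVectorFields d q ι π ⧸ vanishingSubmodule d q ι π p

/-- The smooth sections of the edge tangent bundle: they are the edge vector fields, an edge
vector field `X` being regarded as the section `p ↦ [X]_p`. -/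
def IsSmoothEdgeSection (ι : Z → M) (π : Z → N) (s : ∀ p : M, EdgeTangentSpace d q ι π p) : Prop :=
  ∃ X : edgeVectorFields d q ι π, ∀ p : M, s p = (vanishingSubmodule d q ι π p).mkQ X

/-- The smooth vector bundle isomorphisms (over the identity of `M`) from the edge tangent bundle
to the tangent bundle: families of linear isomorphisms between the fibres under which the smooth
sections of the two bundles correspond to each other. -/
structure EdgeTangentIso (ι : Z → M) (π : Z → N) where
  toEquiv : ∀ p : M, EdgeTangentSpace d q ι π p ≃ₗ[ℝ] TangentSpace (𝓡 (d + 1)) p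
  smooth_iff : ∀ s : (∀ p : M, EdgeTangentSpace d q ι π p),
    IsSmoothEdgeSection d q ι π s ↔
      ContMDiff (𝓡 (d + 1)) (𝓡 (d + 1)).tangent ∞
        (fun p => (⟨p, toEquiv p (s p)⟩ : TangentBundle (𝓡 (d + 1)) M))

end Bundle

/-! ### The associated graph -/

/-- A graph given by the set of end nodes of each edge. Parallel edges are allowed, and an edge
with only one end node is a loop. -/
structure IncidenceGraph (V E : Type*) where
  ends : E → Set V

/-- The graph is two-colorable: the nodes can be coloured with two colours in such a way that the
two end nodes of every edge are coloured differently. In particular there are no loops. -/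
def IncidenceGraph.TwoColorable {V E : Type*} (G : IncidenceGraph V E) : Prop :=
  ∃ c : V → Bool, ∀ e : E, ∃ a b : V, G.ends e = {a, b} ∧ c a ≠ c b

/-- The associated graph of `(M, Z)`: the nodes are the connected components of `M ∖ Z`, the edges
are the connected components of `Z`, and a component `α` of `M ∖ Z` is an end node of a
component `γ` of `Z` if the closure of `α` in `M` meets `γ`. -/
def associatedGraph {M Z : Type*} [TopologicalSpace M] [TopologicalSpace Z] (ι : Z → M) :
    IncidenceGraph (ConnectedComponents ((Set.range ι)ᶜ : Set M)) (ConnectedComponents Z) where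
  ends γ := {α |
    (closure {x : M | ∃ h : x ∈ (Set.range ι)ᶜ,
        ConnectedComponents.mk (⟨x, h⟩ : ((Set.range ι)ᶜ : Set M)) = α} ∩
      ι '' {z : Z | ConnectedComponents.mk z = γ}).Nonempty}

end EdgeGeometry

end

noncomputable section

open Set Filter Topology

namespace EdgeGeometry

/-! Evaluation of edge fields gives the anchor map from the edge tangent bundle to `TM`. Composed
with the inverse of an isomorphism `φ`, it becomes an endomorphism of `TM` with determinant `D =
anchorDet φ`. Away from `Z` edge fields are locally arbitrary, so `D` has no zeros there and its
sign is constant on each component of the complement. Near `Z`, in coordinates `(y, t, x)` (base,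
fibre, normal), edge fields are spanned by `x ∂_y`, `∂_t`, `x ∂_x`, so `D` is `x ^ (q + 1)` times a
nonvanishing factor. As `q + 1 = dim M - dim F` is odd, `D` changes sign across `Z`, and its sign is
the colouring.

Both local computations are cases of `exists_anchorDet_mul_eq`: `eventually_anchorDet_pos_iff` takes
the identity as local frame, `exists_chart_anchorDet` takes `edgeScaling`. Then
`exists_preconnected_sides` converts the odd power into two connected sides of opposite sign, and
`twoColorable_of_sign_change` is the topological conclusion. -/

/-! ### From a sign change to a two-colouring. -/

/-- Two points of a preconnected subset of `S` lie in the same connected component of `S`. -/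
theorem node_eq_of_isPreconnected {M : Type*} [TopologicalSpace M] {S P : Set M}
    (hP : IsPreconnected P) (hPS : P ⊆ S) {x y : M} (hx : x ∈ P) (hy : y ∈ P) :
    ConnectedComponents.mk (⟨x, hPS hx⟩ : S) = ConnectedComponents.mk ⟨y, hPS hy⟩ := by
  have h : IsPreconnected ((Subtype.val : S → M) ⁻¹' P) := by
    rw [← IsInducing.subtypeVal.isPreconnected_image, Subtype.image_preimage_coe,
      inter_eq_right.2 hPS]
    exact hP
  exact ConnectedComponents.coe_eq_coe'.2
    (h.subset_connectedComponent (x := ⟨y, hPS hy⟩) hy (show x ∈ P from hx))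

/-- If a function on `M` has locally constant sign off the closed hypersurface and changes sign
across it, then the associated graph is two-colorable. -/
theorem twoColorable_of_sign_change {M Z : Type*} [TopologicalSpace M] [TopologicalSpace Z]
    {ι : Z → M} (hι : Continuous ι) (D : M → ℝ)
    (hoff : ∀ p ∉ range ι, ∀ᶠ x in 𝓝 p, (0 < D x ↔ 0 < D p))
    (hon : ∀ z : Z, ∃ P Q : Set M, IsPreconnected P ∧ IsPreconnected Q ∧
      P ⊆ (range ι)ᶜ ∧ Q ⊆ (range ι)ᶜ ∧ (∀ x ∈ P, 0 < D x) ∧ (∀ x ∈ Q, D x < 0) ∧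
      ι z ∈ closure P ∧ ι z ∈ closure Q ∧ ∀ᶠ x in 𝓝 (ι z), x ∈ range ι ∨ x ∈ P ∨ x ∈ Q) :
    (associatedGraph ι).TwoColorable := by
  classical
  let S : Set M := (range ι)ᶜ
  let node : ConnectedComponents S → Set M := fun α =>
    {x : M | ∃ h : x ∈ S, ConnectedComponents.mk (⟨x, h⟩ : S) = α}
  have hc : Continuous (fun x : S => decide (0 < D x)) := by
    refine IsLocallyConstant.continuous ((IsLocallyConstant.iff_eventually_eq _).2 fun p => ?_)
    filter_upwards [continuous_subtype_val.continuousAt.eventually (hoff p p.2)] with x hx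
    simpa using hx
  let c : ConnectedComponents S → Bool := hc.connectedComponentsLift
  have hcmk (x : M) (hx : x ∈ S) : c (ConnectedComponents.mk ⟨x, hx⟩) = decide (0 < D x) :=
    hc.connectedComponentsLift_apply_coe ⟨x, hx⟩
  let ends (z : Z) : Set (ConnectedComponents S) := {α | ι z ∈ closure (node α)}
  have key (z : Z) : ∃ a b, c a = true ∧ c b = false ∧ a ∈ ends z ∧ b ∈ ends z ∧
      ∀ᶠ y in 𝓝 (ι z), ∀ α, y ∈ closure (node α) → α = a ∨ α = b := by
    obtain ⟨P, Q, hP, hQ, hPS, hQS, hDP, hDQ, hzP, hzQ, hU⟩ := hon z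
    obtain ⟨x, hx⟩ : P.Nonempty := closure_nonempty_iff.1 ⟨_, hzP⟩
    obtain ⟨y, hy⟩ : Q.Nonempty := closure_nonempty_iff.1 ⟨_, hzQ⟩
    refine ⟨ConnectedComponents.mk ⟨x, hPS hx⟩, ConnectedComponents.mk ⟨y, hQS hy⟩, ?_, ?_,
      closure_mono (fun w hw => show w ∈ node _ from ⟨hPS hw, node_eq_of_isPreconnected hP hPS hw hx⟩) hzP,
      closure_mono (fun w hw => show w ∈ node _ from ⟨hQS hw, node_eq_of_isPreconnected hQ hQS hw hy⟩) hzQ, ?_⟩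
    · rw [hcmk]; simpa using hDP x hx
    · rw [hcmk]; simpa using (hDQ y hy).le
    · filter_upwards [eventually_eventually_nhds.2 hU] with w hw α hα
      obtain ⟨v, ⟨hvS, rfl⟩, hv⟩ := (mem_closure_iff_frequently.1 hα).and_eventually hw |>.exists
      rcases hv with hv | hv | hv
      · exact absurd hv hvS
      · exact Or.inl (node_eq_of_isPreconnected hP hPS hv hx)
      · exact Or.inr (node_eq_of_isPreconnected hQ hQS hv hy)
  choose a b hca hcb ha hb hab using key
  -- The colours tell the two candidates apart, so the ordered pair of end nodes, not just the set,
  -- is locally constant along `Z`.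
  have hends (z z' : Z) (h : ∀ α, ι z' ∈ closure (node α) → α = a z ∨ α = b z) :
      a z' = a z ∧ b z' = b z := by
    constructor
    · refine (h _ (ha z')).resolve_right fun hh => ?_
      have := hca z'
      rw [hh, hcb] at this
      cases this
    · refine (h _ (hb z')).resolve_left fun hh => ?_
      have := hcb z'
      rw [hh, hca] at this
      cases this
  have hconst : IsLocallyConstant (fun z => (a z, b z)) := by
    refine (IsLocallyConstant.iff_eventually_eq _).2 fun z => ?_
    filter_upwards [hι.continuousAt.eventually (hab z)] with z' hz'
    exact Prod.ext (hends z z' hz').1 (hends z z' hz').2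
  refine ⟨c, fun γ => ?_⟩
  obtain ⟨z, rfl⟩ := ConnectedComponents.surjective_coe γ
  refine ⟨a z, b z, ?_, by rw [hca, hcb]; decide⟩
  ext α
  constructor
  · rintro ⟨_, hx, z', hz', rfl⟩
    have h : (a z', b z') = (a z, b z) := hconst.apply_eq_of_isPreconnected
      isPreconnected_connectedComponent (ConnectedComponents.coe_eq_coe'.1 hz')
      mem_connectedComponent
    have := (hab z').self_of_nhds α hx
    obtain ⟨ha', hb'⟩ := Prod.ext_iff.1 h
    rwa [show a z' = a z from ha', show b z' = b z from hb'] at this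
  · rintro (rfl | rfl)
    · exact ⟨ι z, ha z, z, rfl, rfl⟩
    · exact ⟨ι z, hb z, z, rfl, rfl⟩

open VectorField

/-! ### Coordinates on a manifold with values in a normed space -/

section Charts

variable {n : ℕ}
  {M : Type*} [TopologicalSpace M] [ChartedSpace (EuclideanSpace ℝ (Fin n)) M]
  [IsManifold (𝓡 n) ∞ M]
  {V : Type*} [NormedAddCommGroup V] [NormedSpace ℝ V]

/-- The differential of a differentiable open partial homeomorphism is invertible. -/
theorem _root_.OpenPartialHomeomorph.MDifferentiable.isInvertible_mfderiv
    {𝕜 : Type*} [NontriviallyNormedField 𝕜]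
    {E : Type*} [NormedAddCommGroup E] [NormedSpace 𝕜 E] {H : Type*} [TopologicalSpace H]
    {I : ModelWithCorners 𝕜 E H} {X : Type*} [TopologicalSpace X] [ChartedSpace H X]
    {E' : Type*} [NormedAddCommGroup E'] [NormedSpace 𝕜 E'] {H' : Type*} [TopologicalSpace H']
    {I' : ModelWithCorners 𝕜 E' H'} {Y : Type*} [TopologicalSpace Y] [ChartedSpace H' Y]
    {e : OpenPartialHomeomorph X Y} (he : e.MDifferentiable I I') {x : X} (hx : x ∈ e.source) :
    (mfderiv I I' e x).IsInvertible :=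
  ⟨he.mfderiv hx, rfl⟩

/-- Local coordinates on `M` with values in a normed space, smooth in both directions. -/
structure IsSmoothChart (Φ : OpenPartialHomeomorph M V) : Prop where
  contMDiffOn : ContMDiffOn (𝓡 n) 𝓘(ℝ, V) ∞ Φ Φ.source
  contMDiffOn_symm : ContMDiffOn 𝓘(ℝ, V) (𝓡 n) ∞ Φ.symm Φ.target

namespace IsSmoothChart

variable {Φ : OpenPartialHomeomorph M V} (hΦ : IsSmoothChart (n := n) Φ)
include hΦ

omit [IsManifold (𝓡 n) ∞ M] in
theorem mdifferentiable : Φ.MDifferentiable (𝓡 n) 𝓘(ℝ, V) :=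
  ⟨hΦ.contMDiffOn.mdifferentiableOn (by simp), hΦ.contMDiffOn_symm.mdifferentiableOn (by simp)⟩

omit [IsManifold (𝓡 n) ∞ M] in
theorem contMDiffAt {p : M} (hp : p ∈ Φ.source) : ContMDiffAt (𝓡 n) 𝓘(ℝ, V) ∞ Φ p :=
  hΦ.contMDiffOn.contMDiffAt (Φ.open_source.mem_nhds hp)

omit [IsManifold (𝓡 n) ∞ M] in
theorem contMDiffAt_symm {u : V} (hu : u ∈ Φ.target) :
    ContMDiffAt 𝓘(ℝ, V) (𝓡 n) ∞ Φ.symm u :=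
  hΦ.contMDiffOn_symm.contMDiffAt (Φ.open_target.mem_nhds hu)

/-- A smooth function `w` on `V` defines a smooth vector field on the domain of the chart. -/
theorem contMDiffOn_pullback [CompleteSpace V] {w : V → V} (hw : ContDiff ℝ ∞ w) :
    ContMDiffOn (𝓡 n) (𝓡 n).tangent ∞
      (fun p => (⟨p, mpullback (𝓡 n) 𝓘(ℝ, V) Φ w p⟩ : TangentBundle (𝓡 n) M))
      Φ.source := fun _ hp =>
  (ContMDiffAt.mpullback_vectorField_preimage (n := ∞)
    (contMDiffAt_vectorSpace_iff_contDiffAt.2 hw.contDiffAt) (hΦ.contMDiffAt hp)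
    (hΦ.mdifferentiable.isInvertible_mfderiv hp) le_rfl).contMDiffWithinAt

end IsSmoothChart

/-- The expression of a vector field in local coordinates. -/
def coordField (Φ : OpenPartialHomeomorph M V) (W : ContMDiffSection (𝓡 n) (EuclideanSpace ℝ (Fin n)) ∞
    (TangentSpace (𝓡 n) : M → Type)) (u : V) : V :=
  mfderiv (𝓡 n) 𝓘(ℝ, V) Φ (Φ.symm u) (W (Φ.symm u))

variable {Φ : OpenPartialHomeomorph M V} (hΦ : IsSmoothChart (n := n) Φ)

theorem coordField_apply (W : ContMDiffSection (𝓡 n) (EuclideanSpace ℝ (Fin n)) ∞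
    (TangentSpace (𝓡 n) : M → Type)) {p : M} (hp : p ∈ Φ.source) :
    coordField Φ W (Φ p) = mfderiv (𝓡 n) 𝓘(ℝ, V) Φ p (W p) := by
  unfold coordField
  rw [Φ.left_inv hp]

include hΦ in
theorem contDiffAt_coordField [CompleteSpace V] (W : ContMDiffSection (𝓡 n) (EuclideanSpace ℝ (Fin n)) ∞
    (TangentSpace (𝓡 n) : M → Type)) {u : V} (hu : u ∈ Φ.target) :
    ContDiffAt ℝ ∞ (coordField Φ W) u := by
  have h : ContMDiffAt 𝓘(ℝ, V) 𝓘(ℝ, V).tangent ∞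
      (fun u => (⟨u, mpullback 𝓘(ℝ, V) (𝓡 n) Φ.symm W u⟩ : TangentBundle 𝓘(ℝ, V) V)) u :=
    ContMDiffAt.mpullback_vectorField_preimage (n := ∞) (W.contMDiff _)
      (hΦ.contMDiffAt_symm hu) (hΦ.mdifferentiable.symm.isInvertible_mfderiv hu) le_rfl
  refine (contMDiffAt_vectorSpace_iff_contDiffAt.1 h).congr_of_eventuallyEq ?_
  filter_upwards [Φ.open_target.mem_nhds hu] with v hv
  -- Pulling back along `Φ.symm` applies the inverse of its differential, which is the differential
  -- of `Φ`.
  rw [mpullback_apply, ContinuousLinearMap.inverse_eq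
    (hΦ.mdifferentiable.symm_comp_deriv (Φ.map_target hv) |> fun h => by
      rw [Φ.right_inv hv] at h; exact h) (hΦ.mdifferentiable.comp_symm_deriv hv)]
  rfl

end Charts

/-! ### The determinant of the anchor map -/

section Determinant

variable {d q : ℕ}
  {M : Type*} [TopologicalSpace M] [ChartedSpace (EuclideanSpace ℝ (Fin (d + 1))) M]
  [IsManifold (𝓡 (d + 1)) ∞ M]
  {Z : Type*} [TopologicalSpace Z] [ChartedSpace (EuclideanSpace ℝ (Fin d)) Z]
  {N : Type*} [TopologicalSpace N] [ChartedSpace (EuclideanSpace ℝ (Fin q)) N]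
  {ι : Z → M} {π : Z → N}

/-- Evaluation of edge vector fields at `p`. -/
def evalEdge (ι : Z → M) (π : Z → N) (p : M) :
    edgeVectorFields d q ι π →ₗ[ℝ] TangentSpace (𝓡 (d + 1)) p where
  toFun X := X.1 p
  map_add' _ _ := rfl
  map_smul' _ _ := rfl

/-- The anchor map from the edge tangent bundle to the tangent bundle. -/
def anchor (ι : Z → M) (π : Z → N) (p : M) :
    EdgeTangentSpace d q ι π p →ₗ[ℝ] TangentSpace (𝓡 (d + 1)) p :=
  (vanishingSubmodule d q ι π p).liftQ (evalEdge ι π p) <| Submodule.span_le.2 <| by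
    rintro W ⟨f, X, -, hf, hW⟩
    change W.1 p = 0
    rw [hW, hf, zero_smul]

/-- The determinant of the endomorphism of the tangent bundle obtained by composing the anchor
map with the inverse of an isomorphism. -/
def anchorDet (φ : EdgeTangentIso d q ι π) (p : M) : ℝ :=
  LinearMap.det (anchor ι π p ∘ₗ (φ.toEquiv p).symm.toLinearMap)

/-- The smooth vector field corresponding to an edge vector field. -/
def EdgeTangentIso.image (φ : EdgeTangentIso d q ι π) (X : edgeVectorFields d q ι π) :
    VectorFields d M :=
  ⟨fun p => φ.toEquiv p ((vanishingSubmodule d q ι π p).mkQ X),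
    (φ.smooth_iff fun p => (vanishingSubmodule d q ι π p).mkQ X).1 ⟨X, fun _ => rfl⟩⟩

theorem anchor_symm_image (φ : EdgeTangentIso d q ι π) (X : edgeVectorFields d q ι π) (p : M) :
    anchor ι π p ((φ.toEquiv p).symm (φ.image X p)) = X.1 p := by
  change anchor ι π p ((φ.toEquiv p).symm (φ.toEquiv p _)) = _
  rw [LinearEquiv.symm_apply_apply]
  rfl

variable {V : Type*} [NormedAddCommGroup V] [NormedSpace ℝ V] [FiniteDimensional ℝ V]
  {Φ : OpenPartialHomeomorph M V} (hΦ : IsSmoothChart (n := d + 1) Φ)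

include hΦ in
/-- Local edge vector fields given in coordinates by `u ↦ S u v` extend to `M` near `p₀`. -/
theorem exists_edgeVectorFields [T2Space M] {p₀ : M} (hp₀ : p₀ ∈ Φ.source)
    {S : V → V →L[ℝ] V} (hS : ContDiff ℝ ∞ S)
    (hedge : ∀ z, ι z ∈ Φ.source → ∀ (w : TangentSpace (𝓡 (d + 1)) (ι z)) (v : V),
      mfderiv (𝓡 (d + 1)) 𝓘(ℝ, V) Φ (ι z) w = S (Φ (ι z)) v → w ∈ fibreTangent d q ι π z) :
    ∃ X : V →ₗ[ℝ] edgeVectorFields d q ι π, ∀ᶠ p in 𝓝 p₀, ∀ v,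
      mfderiv (𝓡 (d + 1)) 𝓘(ℝ, V) Φ p ((X v).1 p) = S (Φ p) v := by
  have : CompleteSpace V := FiniteDimensional.complete ℝ V
  -- A cutoff supported in the chart extends the local fields by zero without leaving the edge
  -- fields.
  obtain ⟨χ, -, hχ⟩ := (SmoothBumpFunction.nhds_basis_tsupport (I := 𝓡 (d + 1)) p₀).mem_iff.1
    (Φ.open_source.mem_nhds hp₀)
  let loc (v : V) (p : M) : TangentSpace (𝓡 (d + 1)) p :=
    mpullback (𝓡 (d + 1)) 𝓘(ℝ, V) Φ (fun u => S u v) p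
  have hloc {p : M} (hp : p ∈ Φ.source) (v : V) :
      mfderiv (𝓡 (d + 1)) 𝓘(ℝ, V) Φ p (loc v p) = S (Φ p) v :=
    (hΦ.mdifferentiable.isInvertible_mfderiv hp).self_apply_inverse _
  let X (v : V) : edgeVectorFields d q ι π :=
    ⟨⟨fun p => χ p • loc v p, ContMDiffOn.smul_section_of_tsupport χ.contMDiff.contMDiffOn
      Φ.open_source hχ (hΦ.contMDiffOn_pullback (hS.clm_apply contDiff_const))⟩, fun z => by
      change χ (ι z) • loc v (ι z) ∈ _
      by_cases hz : ι z ∈ Φ.source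
      · exact Submodule.smul_mem _ _ (hedge z hz _ v (hloc hz v))
      · rw [image_eq_zero_of_notMem_tsupport fun h => hz (hχ h), zero_smul]
        exact Submodule.zero_mem _⟩
  refine ⟨⟨⟨X, fun v w => ?_⟩, fun c v => ?_⟩, ?_⟩
  · refine Subtype.ext (ContMDiffSection.ext fun p => ?_)
    change χ p • (mfderiv (𝓡 (d + 1)) 𝓘(ℝ, V) Φ p).inverse (S (Φ p) (v + w)) =
      χ p • (mfderiv (𝓡 (d + 1)) 𝓘(ℝ, V) Φ p).inverse (S (Φ p) v) +
      χ p • (mfderiv (𝓡 (d + 1)) 𝓘(ℝ, V) Φ p).inverse (S (Φ p) w)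
    rw [map_add, ← smul_add]
    congr 1
    exact map_add _ _ _
  · refine Subtype.ext (ContMDiffSection.ext fun p => ?_)
    change χ p • (mfderiv (𝓡 (d + 1)) 𝓘(ℝ, V) Φ p).inverse (S (Φ p) (c • v)) =
      c • (χ p • (mfderiv (𝓡 (d + 1)) 𝓘(ℝ, V) Φ p).inverse (S (Φ p) v))
    rw [map_smul, smul_comm]
    congr 1
    exact map_smul _ _ _
  · filter_upwards [χ.eventuallyEq_one, Φ.open_source.mem_nhds hp₀] with p hp hps v
    change mfderiv (𝓡 (d + 1)) 𝓘(ℝ, V) Φ p (χ p • loc v p) = _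
    rw [hp, Pi.one_apply, one_smul, hloc hps]

include hΦ in
/-- In coordinates in which the edge vector fields near `p₀` are spanned by `u ↦ S u v`, the
determinant of the anchor map is, up to a factor without zeros, the determinant of `S`. -/
theorem exists_anchorDet_mul_eq [T2Space M] (φ : EdgeTangentIso d q ι π)
    {p₀ : M} (hp₀ : p₀ ∈ Φ.source) {S : V → V →L[ℝ] V} (hS : ContDiff ℝ ∞ S)
    (hedge : ∀ z, ι z ∈ Φ.source → ∀ (w : TangentSpace (𝓡 (d + 1)) (ι z)) (v : V),
      mfderiv (𝓡 (d + 1)) 𝓘(ℝ, V) Φ (ι z) w = S (Φ (ι z)) v → w ∈ fibreTangent d q ι π z)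
    (hinj : ∀ W ∈ vanishingSubmodule d q ι π p₀, ∀ v,
      (∀ᶠ p in 𝓝 p₀, mfderiv (𝓡 (d + 1)) 𝓘(ℝ, V) Φ p (W.1 p) = S (Φ p) v) → v = 0) :
    ∃ g : M → ℝ, ContinuousAt g p₀ ∧ g p₀ ≠ 0 ∧
      ∀ᶠ p in 𝓝 p₀, anchorDet φ p * g p = (S (Φ p)).det := by
  have : CompleteSpace V := FiniteDimensional.complete ℝ V
  obtain ⟨X, hX⟩ := exists_edgeVectorFields (π := π) hΦ hp₀ hS hedge
  let L (p : M) : TangentSpace (𝓡 (d + 1)) p →ₗ[ℝ] V :=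
    (mfderiv (𝓡 (d + 1)) 𝓘(ℝ, V) Φ p).toLinearMap
  let T (p : M) : V →ₗ[ℝ] V :=
    L p ∘ₗ (φ.toEquiv p).toLinearMap ∘ₗ (vanishingSubmodule d q ι π p).mkQ ∘ₗ X
  have hT (p : M) (v : V) : T p v = mfderiv (𝓡 (d + 1)) 𝓘(ℝ, V) Φ p (φ.image (X v) p) := rfl
  refine ⟨fun p => (T p).toContinuousLinearMap.det, ?_, ?_, ?_⟩
  · refine ContinuousLinearMap.continuous_det.continuousAt.comp (continuousAt_clm_apply.2 fun v => ?_)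
    refine ContinuousAt.congr (f := coordField Φ (φ.image (X v)) ∘ Φ) ?_ ?_
    · exact ((contDiffAt_coordField hΦ _ (Φ.map_source hp₀)).continuousAt).comp
        (Φ.continuousAt hp₀)
    · filter_upwards [Φ.open_source.mem_nhds hp₀] with p hp
      exact coordField_apply _ hp
  -- A vector killed by `T p₀` gives a field in `𝔪_p Γ`, which `hinj` excludes unless the vector is
  -- zero. Injectivity suffices, `T p₀` being an endomorphism of `V`; no spanning property of the
  -- frame is needed.
  · change LinearMap.det (T p₀) ≠ 0
    rw [Ne, LinearMap.det_eq_zero_iff_ker_ne_bot, not_not, LinearMap.ker_eq_bot']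
    intro v hv
    have h1 := (injective_iff_map_eq_zero (L p₀)).1
      (hΦ.mdifferentiable.mfderiv_injective hp₀) _ hv
    have h2 := (Submodule.Quotient.mk_eq_zero _).1
      ((LinearEquiv.map_eq_zero_iff (φ.toEquiv p₀)).1 h1)
    exact hinj _ h2 v (hX.mono fun p hp => hp v)
  · filter_upwards [hX, Φ.open_source.mem_nhds hp₀] with p hp hps
    let e : TangentSpace (𝓡 (d + 1)) p ≃ₗ[ℝ] V := (hΦ.mdifferentiable.mfderiv hps).toLinearEquiv
    change anchorDet φ p * LinearMap.det (T p) = LinearMap.det (S (Φ p)).toLinearMap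
    -- In coordinates the endomorphism sends `T p v`, the image of the frame field under `φ`, back
    -- to the frame field `S (Φ p) v`; multiplicativity of the determinant finishes.
    rw [anchorDet, ← LinearMap.det_conj _ e, ← LinearMap.det_comp]
    congr 1
    ext v
    change L p (anchor ι π p ((φ.toEquiv p).symm (e.symm (e (φ.image (X v) p))))) = _
    rw [e.symm_apply_apply, anchor_symm_image]
    exact hp v

end Determinant

/-! ### Coordinates adapted to an edge structure -/

section ChartOperations

variable {n : ℕ} {M : Type*} [TopologicalSpace M] [ChartedSpace (EuclideanSpace ℝ (Fin n)) M]
  {V : Type*} [NormedAddCommGroup V] [NormedSpace ℝ V]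
  {V' : Type*} [NormedAddCommGroup V'] [NormedSpace ℝ V']

namespace IsSmoothChart

theorem of_mem_maximalAtlas [IsManifold (𝓡 n) ∞ M]
    {c : OpenPartialHomeomorph M (EuclideanSpace ℝ (Fin n))}
    (hc : c ∈ IsManifold.maximalAtlas (𝓡 n) ∞ M) : IsSmoothChart (n := n) c :=
  ⟨contMDiffOn_of_mem_maximalAtlas hc, contMDiffOn_symm_of_mem_maximalAtlas hc⟩

theorem trans {Φ : OpenPartialHomeomorph M V} (hΦ : IsSmoothChart (n := n) Φ)
    {f : OpenPartialHomeomorph V V'} (hf : ContDiffOn ℝ ∞ f f.source)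
    (hf' : ContDiffOn ℝ ∞ f.symm f.target) : IsSmoothChart (n := n) (Φ.trans f) where
  contMDiffOn := hf.contMDiffOn.comp (hΦ.contMDiffOn.mono fun _ hx => hx.1) fun _ hx => hx.2
  contMDiffOn_symm := hΦ.contMDiffOn_symm.comp (hf'.contMDiffOn.mono fun _ hx => hx.1)
    fun _ hx => hx.2

theorem restrOpen {Φ : OpenPartialHomeomorph M V} (hΦ : IsSmoothChart (n := n) Φ) {s : Set M}
    (hs : IsOpen s) : IsSmoothChart (n := n) (Φ.restrOpen s hs) where
  contMDiffOn := hΦ.contMDiffOn.mono fun _ hx => hx.1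
  contMDiffOn_symm := hΦ.contMDiffOn_symm.mono fun _ hx => hx.1

theorem contDiffOn_symm_trans {Φ : OpenPartialHomeomorph M V} {Ψ : OpenPartialHomeomorph M V'}
    (hΦ : IsSmoothChart (n := n) Φ) (hΨ : IsSmoothChart (n := n) Ψ) :
    ContDiffOn ℝ ∞ (Φ.symm.trans Ψ) (Φ.symm.trans Ψ).source :=
  contMDiffOn_iff_contDiffOn.1 <|
    hΨ.contMDiffOn.comp (hΦ.contMDiffOn_symm.mono fun _ hx => hx.1) fun _ hx => hx.2

end IsSmoothChart

end ChartOperations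

/-- A smooth fibration is, in suitable coordinates of the base and the total space, a linear
projection. -/
theorem IsSmoothFibration.exists_chart {d q r : ℕ}
    {Z : Type*} [TopologicalSpace Z] [ChartedSpace (EuclideanSpace ℝ (Fin d)) Z]
    {N : Type*} [TopologicalSpace N] [ChartedSpace (EuclideanSpace ℝ (Fin q)) N]
    [IsManifold (𝓡 q) ∞ N]
    {F : Type*} [TopologicalSpace F] [ChartedSpace (EuclideanSpace ℝ (Fin r)) F]
    [IsManifold (𝓡 r) ∞ F] {π : Z → N} (h : IsSmoothFibration d q r F π) (z : Z) :
    ∃ (Θ : OpenPartialHomeomorph Z (EuclideanSpace ℝ (Fin q) × EuclideanSpace ℝ (Fin r)))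
      (c : OpenPartialHomeomorph N (EuclideanSpace ℝ (Fin q))),
      IsSmoothChart (n := d) Θ ∧ IsSmoothChart (n := q) c ∧ z ∈ Θ.source ∧
      ∀ x ∈ Θ.source, π x ∈ c.source ∧ c (π x) = (Θ x).1 := by
  obtain ⟨e, hz, he, he'⟩ := h (π z)
  have hze : z ∈ e.source := e.mem_source.2 hz
  let c := chartAt (EuclideanSpace ℝ (Fin q)) (π z)
  let c' := chartAt (EuclideanSpace ℝ (Fin r)) (e z).2
  have hc : IsSmoothChart (n := q) c :=
    .of_mem_maximalAtlas (IsManifold.chart_mem_maximalAtlas _)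
  have hc' : IsSmoothChart (n := r) c' :=
    .of_mem_maximalAtlas (IsManifold.chart_mem_maximalAtlas _)
  refine ⟨e.toOpenPartialHomeomorph.trans (c.prod c'), c, ⟨?_, ?_⟩, hc, ?_, ?_⟩
  · have he := he.mono (t := (e.toOpenPartialHomeomorph.trans (c.prod c')).source)
      fun _ hx => hx.1
    exact (hc.contMDiffOn.comp (contMDiff_fst.comp_contMDiffOn he) fun _ hx => hx.2.1).prodMk_space
      (hc'.contMDiffOn.comp (contMDiff_snd.comp_contMDiffOn he) fun _ hx => hx.2.2)
  · refine he'.comp (ContMDiffOn.prodMk ?_ ?_) fun _ hx => hx.2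
    · exact hc.contMDiffOn_symm.comp contDiff_fst.contMDiff.contMDiffOn fun _ hx => hx.1.1
    · exact hc'.contMDiffOn_symm.comp contDiff_snd.contMDiff.contMDiffOn fun _ hx => hx.1.2
  · refine ⟨hze, ?_, mem_chart_source _ _⟩
    change (e z).1 ∈ c.source
    rw [e.coe_fst hze]
    exact mem_chart_source _ _
  · rintro x ⟨hx, hx', -⟩
    have : (e x).1 = π x := e.coe_fst hx
    rw [← this]
    exact ⟨hx', rfl⟩

section AdaptedChart

variable {d q r : ℕ}
  {M : Type*} [TopologicalSpace M] [ChartedSpace (EuclideanSpace ℝ (Fin (d + 1))) M]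
  {Z : Type*} [TopologicalSpace Z] [ChartedSpace (EuclideanSpace ℝ (Fin d)) Z]
  {N : Type*} [TopologicalSpace N] [ChartedSpace (EuclideanSpace ℝ (Fin q)) N]

/-- The values of coordinates adapted to an edge structure: base, fibre and normal coordinate. -/
abbrev EdgeModel (q r : ℕ) : Type :=
  (EuclideanSpace ℝ (Fin q) × EuclideanSpace ℝ (Fin r)) × ℝ

/-- Coordinates of `M` adapted to the hypersurface. -/
theorem exists_slice_chart [IsManifold (𝓡 (d + 1)) ∞ M] [IsManifold (𝓡 d) ∞ Z] {ι : Z → M}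
    (hι : Manifold.IsSmoothEmbedding (𝓡 d) (𝓡 (d + 1)) ∞ ι)
    {E : Type*} [NormedAddCommGroup E] [NormedSpace ℝ E] {Θ : OpenPartialHomeomorph Z E}
    (hΘ : IsSmoothChart (n := d) Θ) {z₀ : Z} (hz₀ : z₀ ∈ Θ.source) :
    ∃ Φ : OpenPartialHomeomorph M (E × ℝ), IsSmoothChart (n := d + 1) Φ ∧ ι z₀ ∈ Φ.source ∧
      (∀ z, ι z ∈ Φ.source → z ∈ Θ.source ∧ Φ (ι z) = (Θ z, 0)) ∧
      ∀ p ∈ Φ.source, (Φ p).2 = 0 → p ∈ range ι := by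
  have h := hι.isImmersion.isImmersionAt z₀
  obtain ⟨a, ha⟩ : ∃ a, a = h.domChart := ⟨_, rfl⟩
  obtain ⟨b, hb⟩ : ∃ b, b = h.codChart := ⟨_, rfl⟩
  have hma : IsSmoothChart (n := d) a := by
    rw [ha]; exact .of_mem_maximalAtlas h.domChart_mem_maximalAtlas
  have hmb : IsSmoothChart (n := d + 1) b := by
    rw [hb]; exact .of_mem_maximalAtlas h.codChart_mem_maximalAtlas
  have hza : z₀ ∈ a.source := by rw [ha]; exact h.mem_domChart_source
  have hab : ∀ z ∈ a.source, ι z ∈ b.source := by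
    rw [ha, hb]; exact h.source_subset_preimage_source
  -- The immersion comes with an abstract normal complement; counting dimensions shows that it is a
  -- line.
  have hfin : Module.finrank ℝ h.complement = Module.finrank ℝ ℝ := by
    have := h.equiv.toLinearEquiv.finrank_eq
    have : FiniteDimensional ℝ h.complement := by
      have : FiniteDimensional ℝ (EuclideanSpace ℝ (Fin d) × h.complement) :=
        h.equiv.symm.toLinearEquiv.finiteDimensional
      exact Module.Finite.of_surjective (LinearMap.snd ℝ (EuclideanSpace ℝ (Fin d)) h.complement)
        LinearMap.snd_surjective
    rw [Module.finrank_prod] at *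
    simp at *
    omega
  have : FiniteDimensional ℝ h.complement := .of_finrank_pos (by simp [hfin])
  let ℓ : h.complement ≃L[ℝ] ℝ := ContinuousLinearEquiv.ofFinrankEq hfin
  let k := h.equiv.symm
  have hk : ∀ z ∈ a.source, k (b (ι z)) = (a z, 0) := by
    intro z hz
    have := h.writtenInCharts (show a z ∈ (h.domChart.extend (𝓡 d)).target by
      simpa [← ha] using a.map_source hz)
    simp [← ha, ← hb, a.left_inv hz] at this
    simp [k, this]
  let τ := a.symm.trans Θ
  have hτ : ContDiffOn ℝ ∞ τ τ.source := hma.contDiffOn_symm_trans hΘ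
  have hτ' : ContDiffOn ℝ ∞ τ.symm τ.target := hΘ.contDiffOn_symm_trans hma
  -- Here the embedding, rather than just the immersion, matters: shrinking to `O` keeps any other
  -- sheet of `Z` out of the chart.
  obtain ⟨O, hO, hOι⟩ := hι.isEmbedding.isInducing.isOpen_iff.1
    (a.open_source.inter Θ.open_source)
  let κ := k.toHomeomorph.toOpenPartialHomeomorph
  let σ := τ.prod ℓ.toHomeomorph.toOpenPartialHomeomorph
  let Φ := ((b.trans κ).trans σ).restrOpen O hO
  have hΦ : IsSmoothChart (n := d + 1) Φ := by
    refine ((hmb.trans ?_ ?_).trans ?_ ?_).restrOpen hO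
    · exact k.contDiff.contDiffOn
    · exact k.symm.contDiff.contDiffOn
    · exact (hτ.comp contDiffOn_fst fun _ hx => hx.1).prodMk
        (ℓ.contDiff.comp contDiff_snd).contDiffOn
    · exact (hτ'.comp contDiffOn_fst fun _ hx => hx.1).prodMk
        (ℓ.symm.contDiff.comp contDiff_snd).contDiffOn
  have hO' (z : Z) : ι z ∈ O ↔ z ∈ a.source ∧ z ∈ Θ.source := by
    rw [← mem_preimage, hOι]; rfl
  refine ⟨Φ, hΦ, ⟨⟨⟨hab _ hza, trivial⟩, ?_, trivial⟩, (hO' _).2 ⟨hza, hz₀⟩⟩, ?_, ?_⟩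
  · change (k (b (ι z₀))).1 ∈ τ.source
    rw [hk _ hza]
    exact ⟨a.map_source hza, by simpa [a.left_inv hza] using hz₀⟩
  · rintro z ⟨-, hz⟩
    obtain ⟨hz1, hz2⟩ := (hO' z).1 hz
    refine ⟨hz2, ?_⟩
    change (Θ (a.symm (k (b (ι z))).1), ℓ (k (b (ι z))).2) = _
    rw [hk _ hz1, a.left_inv hz1, map_zero]
  · rintro p ⟨⟨⟨hp, -⟩, hp', -⟩, -⟩ hp0
    have h0 : (k (b p)).2 = 0 := (map_eq_zero_iff ℓ ℓ.injective).1 hp0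
    have hu : (k (b p)).1 ∈ a.target := hp'.1
    have hz := a.map_target hu
    refine ⟨a.symm (k (b p)).1, b.injOn (hab _ hz) hp (k.injective ?_)⟩
    rw [hk _ hz, a.right_inv hu]
    exact Prod.ext rfl h0.symm

/-- In adapted coordinates the fibres are given by constant base and zero normal coordinate. -/
theorem mem_fibreTangent_iff {ι : Z → M} {π : Z → N}
    (hι : ContMDiff (𝓡 d) (𝓡 (d + 1)) ∞ ι)
    {Θ : OpenPartialHomeomorph Z (EuclideanSpace ℝ (Fin q) × EuclideanSpace ℝ (Fin r))}
    {c : OpenPartialHomeomorph N (EuclideanSpace ℝ (Fin q))}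
    {Φ : OpenPartialHomeomorph M (EdgeModel q r)}
    (hΘ : IsSmoothChart (n := d) Θ) (hc : IsSmoothChart (n := q) c)
    (hΦ : IsSmoothChart (n := d + 1) Φ)
    (hπ : ∀ x ∈ Θ.source, π x ∈ c.source ∧ c (π x) = (Θ x).1)
    (hΦι : ∀ z, ι z ∈ Φ.source → z ∈ Θ.source ∧ Φ (ι z) = (Θ z, 0))
    {z : Z} (hz : ι z ∈ Φ.source) (w : TangentSpace (𝓡 (d + 1)) (ι z)) :
    w ∈ fibreTangent d q ι π z ↔ ∃ t : EuclideanSpace ℝ (Fin r),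
      mfderiv (𝓡 (d + 1)) 𝓘(ℝ, EdgeModel q r) Φ (ι z) w = ((0, t), 0) := by
  have hzΘ := (hΦι z hz).1
  have hdι : MDifferentiableAt (𝓡 d) (𝓡 (d + 1)) ι z := hι.mdifferentiableAt (by simp)
  have hdΘ := hΘ.mdifferentiable.mdifferentiableAt hzΘ
  have hdΦ := hΦ.mdifferentiable.mdifferentiableAt hz
  have hdc := hc.mdifferentiable.mdifferentiableAt (hπ z hzΘ).1
  -- Differentiability of `π` has to be derived from its local form `c.symm ∘ fst ∘ Θ`; otherwise
  -- `mfderiv` could be its default value zero, with kernel the whole tangent space.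
  have hdπ : MDifferentiableAt (𝓡 d) (𝓡 q) π z := by
    have hs : MDifferentiableAt 𝓘(ℝ, EuclideanSpace ℝ (Fin q)) (𝓡 q) c.symm (Θ z).1 :=
      hc.mdifferentiable.mdifferentiableAt_symm (by
        rw [← (hπ z hzΘ).2]; exact c.map_source (hπ z hzΘ).1)
    have hf : MDifferentiableAt (𝓡 d) 𝓘(ℝ, EuclideanSpace ℝ (Fin q)) (fun x => (Θ x).1) z :=
      (((ContinuousLinearMap.fst ℝ (EuclideanSpace ℝ (Fin q))
        (EuclideanSpace ℝ (Fin r))).hasMFDerivAt).comp z hdΘ.hasMFDerivAt).mdifferentiableAt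
    refine (hs.comp z hf).congr_of_eventuallyEq ?_
    filter_upwards [Θ.open_source.mem_nhds hzΘ] with x hx
    simp [← (hπ x hx).2, c.left_inv (hπ x hx).1]
  have h1 (v : TangentSpace (𝓡 d) z) :
      mfderiv (𝓡 (d + 1)) 𝓘(ℝ, EdgeModel q r) Φ (ι z) (mfderiv (𝓡 d) (𝓡 (d + 1)) ι z v) =
      (mfderiv (𝓡 d) 𝓘(ℝ, EuclideanSpace ℝ (Fin q) × EuclideanSpace ℝ (Fin r)) Θ z v, 0) := by
    have e1 := (hdΦ.hasMFDerivAt.comp z hdι.hasMFDerivAt)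
    have e2 : HasMFDerivAt (𝓡 d) 𝓘(ℝ, EdgeModel q r) (fun x => (Θ x, (0 : ℝ))) z _ :=
      ((ContinuousLinearMap.inl ℝ (EuclideanSpace ℝ (Fin q) × EuclideanSpace ℝ (Fin r))
        ℝ).hasMFDerivAt).comp z hdΘ.hasMFDerivAt
    have e3 := e2.congr_of_eventuallyEq (f₁ := Φ ∘ ι) (by
      filter_upwards [hι.continuous.continuousAt.preimage_mem_nhds (Φ.open_source.mem_nhds hz)]
        with x hx using (hΦι x hx).2)
    exact DFunLike.congr_fun (hasMFDerivAt_unique e1 e3) v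
  have h2 (v : TangentSpace (𝓡 d) z) :
      mfderiv (𝓡 q) 𝓘(ℝ, EuclideanSpace ℝ (Fin q)) c (π z) (mfderiv (𝓡 d) (𝓡 q) π z v) =
      (mfderiv (𝓡 d) 𝓘(ℝ, EuclideanSpace ℝ (Fin q) × EuclideanSpace ℝ (Fin r)) Θ z v).1 := by
    have e1 := (hdc.hasMFDerivAt.comp z hdπ.hasMFDerivAt)
    have e2 : HasMFDerivAt (𝓡 d) 𝓘(ℝ, EuclideanSpace ℝ (Fin q)) (fun x => (Θ x).1) z _ :=
      ((ContinuousLinearMap.fst ℝ (EuclideanSpace ℝ (Fin q))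
        (EuclideanSpace ℝ (Fin r))).hasMFDerivAt).comp z hdΘ.hasMFDerivAt
    have e3 := e2.congr_of_eventuallyEq (f₁ := c ∘ π) (by
      filter_upwards [Θ.open_source.mem_nhds hzΘ] with x hx using (hπ x hx).2)
    exact DFunLike.congr_fun (hasMFDerivAt_unique e1 e3) v
  constructor
  · rintro ⟨v, hv, rfl⟩
    have hv : mfderiv (𝓡 d) (𝓡 q) π z v = 0 := hv
    refine ⟨(mfderiv (𝓡 d) 𝓘(ℝ, EuclideanSpace ℝ (Fin q) × EuclideanSpace ℝ (Fin r)) Θ z v).2,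
      (h1 v).trans ?_⟩
    have := h2 v
    rw [hv, map_zero] at this
    exact Prod.ext (Prod.ext this.symm rfl) rfl
  · rintro ⟨t, ht⟩
    obtain ⟨v, hv⟩ := hΘ.mdifferentiable.mfderiv_surjective hzΘ
      ((0, t) : EuclideanSpace ℝ (Fin q) × EuclideanSpace ℝ (Fin r))
    refine ⟨v, ?_, hΦ.mdifferentiable.mfderiv_injective hz ?_⟩
    · refine hc.mdifferentiable.mfderiv_injective (hπ z hzΘ).1 ((h2 v).trans ?_)
      rw [hv, map_zero]
      rfl
    · refine (h1 v).trans ?_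
      rw [hv, ht]
      rfl

end AdaptedChart

/-! ### The anchor map in adapted coordinates -/

section EdgeScaling

variable {q r : ℕ}

/-- In adapted coordinates the edge vector fields are spanned by the fields `u ↦ edgeScaling u v`:
the base and normal directions are multiplied by the normal coordinate. -/
def edgeScaling (u : EdgeModel q r) : EdgeModel q r →L[ℝ] EdgeModel q r :=
  u.2 • ((ContinuousLinearMap.id ℝ (EuclideanSpace ℝ (Fin q))).prodMap
      (0 : EuclideanSpace ℝ (Fin r) →L[ℝ] EuclideanSpace ℝ (Fin r))).prodMap
        (ContinuousLinearMap.id ℝ ℝ) +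
    ((0 : EuclideanSpace ℝ (Fin q) →L[ℝ] EuclideanSpace ℝ (Fin q)).prodMap
      (ContinuousLinearMap.id ℝ (EuclideanSpace ℝ (Fin r)))).prodMap (0 : ℝ →L[ℝ] ℝ)

theorem edgeScaling_apply (u v : EdgeModel q r) :
    edgeScaling u v = ((u.2 • v.1.1, v.1.2), u.2 * v.2) := by
  obtain ⟨⟨a, b⟩, c⟩ := v
  simp [edgeScaling]

theorem contDiff_edgeScaling : ContDiff ℝ ∞ (edgeScaling (q := q) (r := r)) :=
  (contDiff_snd.smul contDiff_const).add contDiff_const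

/-- The `q` base directions and the normal direction each contribute a factor `u.2`, the fibre
directions contribute `1`. -/
theorem det_edgeScaling (u : EdgeModel q r) : (edgeScaling u).det = u.2 ^ (q + 1) := by
  have h : (edgeScaling u : EdgeModel q r →ₗ[ℝ] EdgeModel q r) =
      ((u.2 • LinearMap.id).prodMap LinearMap.id).prodMap (u.2 • LinearMap.id) := by
    refine LinearMap.ext fun v => ?_
    exact (edgeScaling_apply u v).trans rfl
  change LinearMap.det (edgeScaling u : EdgeModel q r →ₗ[ℝ] EdgeModel q r) = _
  rw [h, LinearMap.det_prodMap, LinearMap.det_prodMap]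
  simp [LinearMap.det_smul, pow_succ]

end EdgeScaling

section Coordinates

variable {d q r : ℕ}
  {M : Type*} [TopologicalSpace M] [ChartedSpace (EuclideanSpace ℝ (Fin (d + 1))) M]
  [IsManifold (𝓡 (d + 1)) ∞ M]
  {Z : Type*} [TopologicalSpace Z] [ChartedSpace (EuclideanSpace ℝ (Fin d)) Z]
  {N : Type*} [TopologicalSpace N] [ChartedSpace (EuclideanSpace ℝ (Fin q)) N]
  {ι : Z → M} {π : Z → N}

theorem eq_zero_of_mem_vanishingSubmodule {p : M} {W : edgeVectorFields d q ι π}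
    (hW : W ∈ vanishingSubmodule d q ι π p) : W.1 p = 0 := by
  have h : anchor ι π p ((vanishingSubmodule d q ι π p).mkQ W) = W.1 p := rfl
  rw [← h, Submodule.mkQ_apply, (Submodule.Quotient.mk_eq_zero _).2 hW, map_zero]

/-- An element of `𝔪_p Γ` vanishes to first order in the fibre directions, and its base and normal
components vanish to second order in the normal direction. -/
theorem coordField_of_mem_vanishingSubmodule {Φ : OpenPartialHomeomorph M (EdgeModel q r)}
    (hΦ : IsSmoothChart (n := d + 1) Φ) {p : M} (hp : p ∈ Φ.source)
    (hfib : ∀ X : edgeVectorFields d q ι π,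
      (coordField Φ X.1 (Φ p)).1.1 = 0 ∧ (coordField Φ X.1 (Φ p)).2 = 0)
    {W : edgeVectorFields d q ι π} (hW : W ∈ vanishingSubmodule d q ι π p) (e : EdgeModel q r) :
    (fderiv ℝ (coordField Φ W.1) (Φ p) e).1.1 = 0 ∧
      (fderiv ℝ (coordField Φ W.1) (Φ p) e).2 = 0 := by
  have hd (X : edgeVectorFields d q ι π) : DifferentiableAt ℝ (coordField Φ X.1) (Φ p) :=
    (contDiffAt_coordField hΦ X.1 (Φ.map_source hp)).differentiableAt (by simp)
  induction hW using Submodule.span_induction with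
  | mem W hW =>
    obtain ⟨f, X, hf, hfp, hW⟩ := hW
    have h : coordField Φ W.1 = fun u => f (Φ.symm u) • coordField Φ X.1 u := by
      ext1 u
      unfold coordField
      rw [hW]
      exact map_smul _ _ _
    have hc : DifferentiableAt ℝ (fun u => f (Φ.symm u)) (Φ p) := by
      have h1 : ContMDiffAt 𝓘(ℝ, EdgeModel q r) 𝓘(ℝ, ℝ) ∞ (f ∘ Φ.symm) (Φ p) :=
        hf.contMDiffAt.comp _ (hΦ.contMDiffAt_symm (Φ.map_source hp))
      exact (contMDiffAt_iff_contDiffAt.1 h1).differentiableAt (by simp)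
    rw [h, fderiv_fun_smul hc (hd X)]
    -- In the product rule one term carries `f p = 0`, the other the value of `X` at `p`, whose base
    -- and normal components vanish.
    simp [Φ.left_inv hp, hfp, hfib X]
  | zero =>
    have h : coordField Φ (0 : edgeVectorFields d q ι π).1 = fun _ => 0 := by
      ext1 u
      exact map_zero (mfderiv (𝓡 (d + 1)) 𝓘(ℝ, EdgeModel q r) Φ (Φ.symm u))
    rw [h]
    simp
  | add W W' _ _ ih ih' =>
    have h : coordField Φ (W + W').1 = fun u => coordField Φ W.1 u + coordField Φ W'.1 u := by
      ext1 u
      exact map_add (mfderiv (𝓡 (d + 1)) 𝓘(ℝ, EdgeModel q r) Φ (Φ.symm u)) _ _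
    rw [h, fderiv_fun_add (hd W) (hd W')]
    simp [ih, ih']
  | smul c W _ ih =>
    have h : coordField Φ (c • W).1 = fun u => c • coordField Φ W.1 u := by
      ext1 u
      exact map_smul (mfderiv (𝓡 (d + 1)) 𝓘(ℝ, EdgeModel q r) Φ (Φ.symm u)) _ _
    rw [h, fderiv_fun_const_smul (hd W)]
    simp [ih]

/-- This is the independence of the frame in the quotient `Γ / 𝔪_p Γ`, although its base and normal
fields vanish on `Z`. The value of `W` at `p` detects the fibre component of `v`; its first
derivative in the normal direction detects the other two. -/
theorem eq_zero_of_edgeScaling_mem {Φ : OpenPartialHomeomorph M (EdgeModel q r)}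
    (hΦ : IsSmoothChart (n := d + 1) Φ) {p : M} (hp : p ∈ Φ.source)
    (hfib : ∀ X : edgeVectorFields d q ι π,
      (coordField Φ X.1 (Φ p)).1.1 = 0 ∧ (coordField Φ X.1 (Φ p)).2 = 0)
    {W : edgeVectorFields d q ι π} (hW : W ∈ vanishingSubmodule d q ι π p) {v : EdgeModel q r}
    (hWv : ∀ᶠ x in 𝓝 p, mfderiv (𝓡 (d + 1)) 𝓘(ℝ, EdgeModel q r) Φ x (W.1 x) =
      edgeScaling (Φ x) v) : v = 0 := by
  have hev : coordField Φ W.1 =ᶠ[𝓝 (Φ p)] fun u => edgeScaling u v := by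
    have h1 := (Φ.continuousAt_symm (Φ.map_source hp)).eventually
      ((Φ.left_inv hp).symm ▸ hWv)
    filter_upwards [h1, Φ.open_target.mem_nhds (Φ.map_source hp)] with u hu hut
    rw [Φ.right_inv hut] at hu
    exact hu
  have hder : HasFDerivAt (fun u : EdgeModel q r => edgeScaling u v)
      ((ContinuousLinearMap.snd ℝ _ ℝ).smulRight (((v.1.1, 0), v.2) : EdgeModel q r)) (Φ p) := by
    have h1 : (fun u : EdgeModel q r => edgeScaling u v) =
        fun u => u.2 • (((v.1.1, 0), v.2) : EdgeModel q r) + ((0, v.1.2), 0) := by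
      ext1 u
      rw [edgeScaling_apply]
      simp
    rw [h1]
    exact (hasFDerivAt_snd.smul_const _).add_const _
  -- The vector `((0, 0), 1)` is the normal direction.
  have h2 := coordField_of_mem_vanishingSubmodule hΦ hp hfib hW ((0, 0), 1)
  rw [hev.fderiv_eq, hder.fderiv] at h2
  have h3 : coordField Φ W.1 (Φ p) = 0 := by
    rw [coordField_apply _ hp, eq_zero_of_mem_vanishingSubmodule hW]
    exact map_zero _
  rw [hev.eq_of_nhds, edgeScaling_apply] at h3
  simp only [ContinuousLinearMap.smulRight_apply, ContinuousLinearMap.coe_snd', one_smul] at h2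
  exact Prod.ext (Prod.ext h2.1 (Prod.ext_iff.1 (Prod.ext_iff.1 h3).1).2) h2.2

/-- Off the hypersurface the sign of the determinant of the anchor map is locally constant. -/
theorem eventually_anchorDet_pos_iff [T2Space M] (hι : IsClosed (range ι))
    (φ : EdgeTangentIso d q ι π) {p : M} (hp : p ∉ range ι) :
    ∀ᶠ x in 𝓝 p, (0 < anchorDet φ x ↔ 0 < anchorDet φ p) := by
  let c := chartAt (EuclideanSpace ℝ (Fin (d + 1))) p
  let Φ := c.restrOpen (range ι)ᶜ hι.isOpen_compl
  have hΦ : IsSmoothChart (n := d + 1) Φ :=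
    (IsSmoothChart.of_mem_maximalAtlas (IsManifold.chart_mem_maximalAtlas p)).restrOpen _
  have hpΦ : p ∈ Φ.source := ⟨mem_chart_source _ _, hp⟩
  obtain ⟨g, hg, hg0, h⟩ := exists_anchorDet_mul_eq hΦ φ hpΦ
    (S := fun _ => ContinuousLinearMap.id ℝ _) contDiff_const
    (fun z hz => absurd (mem_range_self z) hz.2) (fun W hW v hv => by
      have := hv.self_of_nhds
      rw [eq_zero_of_mem_vanishingSubmodule hW] at this
      exact this.symm.trans (map_zero _))
  have h1 : ∀ᶠ x in 𝓝 p, (0 < g x ↔ 0 < g p) := by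
    rcases hg0.lt_or_gt with h0 | h0
    · filter_upwards [hg.eventually_lt_const h0] with x hx
      exact iff_of_false hx.not_gt h0.not_gt
    · filter_upwards [hg.eventually_const_lt h0] with x hx
      exact iff_of_true hx h0
  -- Here `S` is the identity, so `D * g = 1` near `p`.
  have h2 : ∀ᶠ x in 𝓝 p, (0 < anchorDet φ x ↔ 0 < g x) := by
    filter_upwards [h] with x hx
    refine pos_iff_pos_of_mul_pos ?_
    rw [hx]
    change 0 < LinearMap.det (LinearMap.id : EuclideanSpace ℝ (Fin (d + 1)) →ₗ[ℝ] _)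
    simp
  filter_upwards [h1, h2] with x hx hx'
  rw [hx', hx, ← h2.self_of_nhds]

/-- Near a point of the hypersurface the determinant of the anchor map is, up to a factor without
zeros, a power of the normal coordinate. -/
theorem exists_chart_anchorDet [T2Space M] [IsManifold (𝓡 d) ∞ Z] [IsManifold (𝓡 q) ∞ N]
    {F : Type*} [TopologicalSpace F] [ChartedSpace (EuclideanSpace ℝ (Fin r)) F]
    [IsManifold (𝓡 r) ∞ F] (hedge : IsEdgeStructure d q r F ι π)
    (φ : EdgeTangentIso d q ι π) (z : Z) :
    d = q + r ∧ ∃ Φ : OpenPartialHomeomorph M (EdgeModel q r), ι z ∈ Φ.source ∧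
      (∀ x ∈ Φ.source, x ∈ range ι ↔ (Φ x).2 = 0) ∧
      ∃ g : M → ℝ, ContinuousAt g (ι z) ∧ g (ι z) ≠ 0 ∧
        ∀ᶠ x in 𝓝 (ι z), anchorDet φ x * g x = (Φ x).2 ^ (q + 1) := by
  obtain ⟨Θ, c, hΘ, hc, hzΘ, hπ⟩ := hedge.isSmoothFibration.exists_chart z
  obtain ⟨Φ, hΦ, hz, hΦι, hΦr⟩ := exists_slice_chart hedge.isSmoothEmbedding hΘ hzΘ
  have hfib {z' : Z} (hz' : ι z' ∈ Φ.source) := mem_fibreTangent_iff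
    hedge.isSmoothEmbedding.contMDiff hΘ hc hΦ hπ hΦι hz'
  refine ⟨?_, Φ, hz, fun x hx => ⟨?_, hΦr x hx⟩, ?_⟩
  -- The relation between the dimensions is read off from the chart at a point of `Z`.
  · have h : Module.finrank ℝ (EuclideanSpace ℝ (Fin (d + 1))) =
        Module.finrank ℝ (EdgeModel q r) :=
      (hΦ.mdifferentiable.mfderiv hz).toLinearEquiv.finrank_eq
    simp only [Module.finrank_prod, finrank_euclideanSpace, Fintype.card_fin,
      Module.finrank_self] at h
    omega
  · rintro ⟨z', rfl⟩
    rw [(hΦι z' hx).2]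
  · simp only [← det_edgeScaling]
    refine exists_anchorDet_mul_eq hΦ φ hz contDiff_edgeScaling (fun z' hz' w v hw => ?_)
      fun W hW v hv => eq_zero_of_edgeScaling_mem hΦ hz (fun X => ?_) hW hv
    · refine (hfib hz' w).2 ⟨v.1.2, hw.trans ?_⟩
      rw [edgeScaling_apply, (hΦι z' hz').2, zero_smul, zero_mul]
    · obtain ⟨t, ht⟩ := (hfib hz (X.1 (ι z))).1 (X.2 z)
      have h : coordField Φ X.1 (Φ (ι z)) = ((0, t), 0) := (coordField_apply X.1 hz).trans ht
      rw [h]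
      exact ⟨rfl, rfl⟩

end Coordinates

/-! ### Sign change across the hypersurface. -/

/-- If the product of `D` with a nonvanishing function is an odd power of a coordinate vanishing
exactly on `R`, then `D` changes sign across `R`. -/
theorem exists_preconnected_sides {M V : Type*} [TopologicalSpace M] [NormedAddCommGroup V]
    [NormedSpace ℝ V] {R : Set M} {Φ : OpenPartialHomeomorph M (V × ℝ)} {p : M}
    (hp : p ∈ Φ.source) (hpR : p ∈ R) (hR : ∀ x ∈ Φ.source, x ∈ R ↔ (Φ x).2 = 0)
    {D g : M → ℝ} (hg : ContinuousAt g p) (hg0 : g p ≠ 0) {m : ℕ} (hm : Odd m)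
    (hD : ∀ᶠ x in 𝓝 p, D x * g x = (Φ x).2 ^ m) :
    ∃ P Q : Set M, IsPreconnected P ∧ IsPreconnected Q ∧ P ⊆ Rᶜ ∧ Q ⊆ Rᶜ ∧
      (∀ x ∈ P, 0 < D x) ∧ (∀ x ∈ Q, D x < 0) ∧ p ∈ closure P ∧ p ∈ closure Q ∧
      ∀ᶠ x in 𝓝 p, x ∈ R ∨ x ∈ P ∨ x ∈ Q := by
  have hpt := Φ.map_source hp
  have hp0 : (Φ p).2 = 0 := (hR p hp).1 hpR
  have hsign : ∀ᶠ x in 𝓝 p, 0 < g p * g x :=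
    (continuousAt_const.mul hg).eventually_const_lt (mul_self_pos.2 hg0)
  have hgood : ∀ᶠ u in 𝓝 (Φ p), u ∈ Φ.target ∧
      D (Φ.symm u) * g (Φ.symm u) = u.2 ^ m ∧ 0 < g p * g (Φ.symm u) := by
    have h := (Φ.continuousAt_symm hpt).eventually
      (p := fun x => D x * g x = (Φ x).2 ^ m ∧ 0 < g p * g x)
      (by rw [Φ.left_inv hp]; exact hD.and hsign)
    filter_upwards [h, Φ.open_target.mem_nhds hpt] with u hu hut
    rw [Φ.right_inv hut] at hu
    exact ⟨hut, hu⟩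
  obtain ⟨ε, hε, hB⟩ := Metric.eventually_nhds_iff_ball.1 hgood
  -- Half-balls on the side where the normal coordinate has the sign of `s`. Choosing `s = ± g p`
  -- later makes the sign of `D` on each side come out without cases on the sign of `g p`.
  let H (s : ℝ) : Set (V × ℝ) := Metric.ball (Φ p) ε ∩ {u | 0 < s * u.2}
  let A (s : ℝ) : Set M := Φ.symm '' H s
  have hA (s : ℝ) : IsPreconnected (A s) := by
    refine Convex.isPreconnected ?_ |>.image _
      (Φ.continuousOn_symm.mono fun u hu => (hB u hu.1).1)
    exact (convex_ball _ _).inter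
      (convex_halfSpace_gt (s • (LinearMap.snd ℝ V ℝ)).isLinear 0)
  have hAR (s : ℝ) : A s ⊆ Rᶜ := by
    rintro _ ⟨u, ⟨huB, hu⟩, rfl⟩ hR'
    have hut := (hB u huB).1
    have := (hR _ (Φ.map_target hut)).1 hR'
    rw [Φ.right_inv hut] at this
    simp [this] at hu
  have hAD (s : ℝ) : ∀ x ∈ A s, 0 < s * g p * D x := by
    rintro _ ⟨u, ⟨huB, hu⟩, rfl⟩
    obtain ⟨-, h1, h2⟩ := hB u huB
    -- Oddness of `m` enters here: `u.2 ^ m` has the sign of `u.2`.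
    have h3 : 0 < s * u.2 ^ m := by
      obtain ⟨k, rfl⟩ := hm
      have hu0 : u.2 ≠ 0 := by rintro h; simp [h] at hu
      rw [pow_succ, mul_left_comm]
      exact mul_pos ((even_two_mul k).pow_pos hu0) hu
    rw [← h1] at h3
    have h4 : 0 < (s * g p * D (Φ.symm u)) * (g (Φ.symm u)) ^ 2 := by
      calc 0 < (s * (D (Φ.symm u) * g (Φ.symm u))) * (g p * g (Φ.symm u)) := mul_pos h3 h2
        _ = _ := by ring
    exact pos_of_mul_pos_left h4 (sq_nonneg _)
  have hAc (s : ℝ) (hs : s ≠ 0) : p ∈ closure (A s) := by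
    -- The point `p` is approached along the normal ray in direction `s`.
    have hc : ContinuousAt (fun t : ℝ => Φ p + (t * s) • ((0, 1) : V × ℝ)) 0 := by fun_prop
    have h0 : Φ p + ((0 : ℝ) * s) • ((0, 1) : V × ℝ) = Φ p := by simp
    have hc' : Tendsto (fun t : ℝ => Φ p + (t * s) • ((0, 1) : V × ℝ)) (𝓝[>] 0) (𝓝 (Φ p)) := by
      have := hc.tendsto
      rw [h0] at this
      exact this.mono_left nhdsWithin_le_nhds
    have hlim := (Φ.continuousAt_symm hpt).tendsto.comp hc'
    rw [Φ.left_inv hp] at hlim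
    refine mem_closure_of_tendsto hlim ?_
    filter_upwards [hc'.eventually (Metric.ball_mem_nhds _ hε), self_mem_nhdsWithin] with t ht ht'
    refine ⟨_, ⟨ht, ?_⟩, rfl⟩
    have : 0 < t * (s * s) := mul_pos ht' (mul_self_pos.2 hs)
    simpa [hp0, mul_left_comm] using this
  refine ⟨A (g p), A (-g p), hA _, hA _, hAR _, hAR _, fun x hx => ?_, fun x hx => ?_,
    hAc _ hg0, hAc _ (neg_ne_zero.2 hg0), ?_⟩
  · exact pos_of_mul_pos_right (hAD _ x hx) (mul_self_nonneg _)
  · have := hAD _ x hx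
    rw [neg_mul, neg_mul, neg_pos] at this
    exact neg_of_mul_neg_right this (mul_self_nonneg _)
  · filter_upwards [Φ.open_source.mem_nhds hp,
      (Φ.continuousAt hp).eventually (Metric.ball_mem_nhds _ hε)] with x hx hxB
    rw [hR x hx]
    rcases lt_trichotomy (g p * (Φ x).2) 0 with h | h | h
    · exact Or.inr (Or.inr ⟨Φ x, ⟨hxB, by simpa using h⟩, Φ.left_inv hx⟩)
    · exact Or.inl ((mul_eq_zero.1 h).resolve_left hg0)
    · exact Or.inr (Or.inl ⟨Φ x, ⟨hxB, h⟩, Φ.left_inv hx⟩)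

end EdgeGeometry

end

theorem mainTheorem11 {d q r : ℕ}
    {M : Type*} [TopologicalSpace M] [T2Space M] [SecondCountableTopology M]
    [ChartedSpace (EuclideanSpace ℝ (Fin (d + 1))) M] [IsManifold (𝓡 (d + 1)) ∞ M]
    {Z : Type*} [TopologicalSpace Z]
    [ChartedSpace (EuclideanSpace ℝ (Fin d)) Z] [IsManifold (𝓡 d) ∞ Z]
    {N : Type*} [TopologicalSpace N] [T2Space N] [SecondCountableTopology N]
    [ChartedSpace (EuclideanSpace ℝ (Fin q)) N] [IsManifold (𝓡 q) ∞ N]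
    {F : Type*} [TopologicalSpace F] [T2Space F] [SecondCountableTopology F]
    [ChartedSpace (EuclideanSpace ℝ (Fin r)) F] [IsManifold (𝓡 r) ∞ F]
    (ι : Z → M) (π : Z → N)
    (hedge : EdgeGeometry.IsEdgeStructure d q r F ι π)
    (hodd : ∃ k : ℤ, ((d + 1 : ℕ) : ℤ) - (r : ℤ) = 2 * k + 1)
    (hiso : Nonempty (EdgeGeometry.EdgeTangentIso d q ι π)) :
    (EdgeGeometry.associatedGraph ι).TwoColorable := by
  obtain ⟨φ⟩ := hiso
  refine EdgeGeometry.twoColorable_of_sign_change hedge.isSmoothEmbedding.isEmbedding.continuous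
    (EdgeGeometry.anchorDet φ)
    (fun p hp => EdgeGeometry.eventually_anchorDet_pos_iff hedge.isClosed_range φ hp) fun z => ?_
  obtain ⟨hd, Φ, hz, hΦ, g, hg, hg0, h⟩ := EdgeGeometry.exists_chart_anchorDet hedge φ z
  -- By `d = q + r`, the codimension `d + 1 - r` of the fibres in `M` is `q + 1`.
  have hq : Odd (q + 1) := by
    obtain ⟨k, hk⟩ := hodd
    rw [← Int.odd_coe_nat]
    exact ⟨k, by push_cast at hk ⊢; omega⟩
  exact EdgeGeometry.exists_preconnected_sides hz (Set.mem_range_self z) hΦ hg hg0 hq h
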